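/- **Setting.** Consider the linear system $x_{k+1}=Ax_k+Bu_k+w_k$, $y_k=Cx_k+v_k$ with $x_k\in\mathbb R^n$, $u_k\in\mathbb R^p$, $y_k\in\mathbb R^m$, where $w_k\sim\mathcal N(0,Q)$ and $v_k\sim\mathcal N(0,R)$ are i.i.d. and independent of each other and of the initial state, and where, given the a priori information, $x_0\sim\mathcal N(\hat x_{0|-1},P_{0|-1})$ with $\hat x_{0|-1}\in\mathbb R^n$ fixed. The defender runs the Kalman filter $$\hat x_{k|k}=(I-K_kC)\hat x_{k|k-1}+K_ky_k,\qquad \hat x_{k+1|k}=A\hat x_{k|k}+Bu_k,\qquad K_k=P_{k|k-1}C^T(CP_{k|k-1}C^T+R)^{-1},$$ $$P_{k+1|k}=AP_{k|k-1}A^T+Q-AK_kCP_{k|k-1}A^T,$$ on the outputs $y_k$ received, and applies the state feedback $u_k=L\hat x_{k|k}$ (no watermarking). The filter is in steady state: $P_{0|-1}=P$ is a positive semidefinite fixed point of the covariance recursion, so that $K_k=K=PC^T\mathcal P^{-1}$ for all $k$, where $\mathcal P=CPC^T+R$ is assumed positive definite. The control loop is assumed to have a steady state: $\hat x_{k|k-1}$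 has a stationary covariance, that is, a positive semidefinite $\mathcal W$ with $$\mathcal W=(A+BL)(\mathcal W+K\mathcal PK^T)(A+BL)^T .$$ **Replay attack.** For the horizon $T$ the adversary uses the outputs $y_{-N},\dots,y_{-N+T}$, with a delay $N=N_T>T$, of a run of the same closed loop that operates normally and is in steady state at time $-N$: $\hat x_{-N|-N-1}\sim\mathcal N(0,\mathcal W)$, and $x_{-N}-\hat x_{-N|-N-1}\sim\mathcal N(0,P)$ is independent of $\hat x_{-N|-N-1}$. These recorded outputs are independent of the run that starts at time $0$. For $0\le k\le T$ the adversary replaces the output at time $k$ received by the defender with $y_{k-N}$, and may moreover add arbitrary inputs $B^au_k^a$ to the state update. The information flow is $$IF_T=\frac1{T+1}\,D_{KL}\big(\text{law of }y_{0:T}\text{ under attack}\,\big\|\,\text{law of }y_{0:T}\text{ in normal operation}\big)\in[0,\infty],$$ both laws being taken given $\hat x_{0|-1}$. **Theorem.** Let $\mathcal A=(A+BL)(I-KC)$. If the spectral radius satisfies $\rho(\mathcal A)<1$, then $\lim_{T\to\infty}IF_T=0$. -/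

import Mathlib

open MeasureTheory ProbabilityTheory InformationTheory Filter Topology
open scoped ENNReal Matrix

/-- Column vectors `ℝⁿ`. -/
abbrev Vec (n : ℕ) := EuclideanSpace ℝ (Fin n)

/-- The data of one run of the plant: `(e, w, v)` with `e` the deviation of the initial state from
the defender's prediction of it, `w k` the process noise and `v k` the measurement noise, `k` steps
after the start of the run. -/
abbrev RunNoise (n m : ℕ) := Vec n × (ℕ → Vec n) × (ℕ → Vec m)

/-- A sample point of the replay experiment: the data of the run which is under attack (started at
time `0`), and, for the run that the adversary recorded (started at time `-N`), the one-step
prediction `x̂_{-N|-N-1}` of the defender together with the data of that run. -/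
abbrev Sample (n m : ℕ) := RunNoise n m × (Vec n × RunNoise n m)

/-- The model `{A, B, C, Q, R, x̂_{0|-1}, P_{0|-1}}` of
`x_{k+1} = A x_k + B u_k + w_k`, `y_k = C x_k + v_k`,
with `n` states, `p` control inputs and `m` sensors. -/
structure LinearSystem (n p m : ℕ) where
  A : Matrix (Fin n) (Fin n) ℝ
  B : Matrix (Fin n) (Fin p) ℝ
  C : Matrix (Fin m) (Fin n) ℝ
  Q : Matrix (Fin n) (Fin n) ℝ
  R : Matrix (Fin m) (Fin m) ℝ
  xhat0 : Vec n
  P0 : Matrix (Fin n) (Fin n) ℝ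

/-- Attack inputs: at time `k` the term `Bᵃ uᵃ_k` is added to the state update and `Dᵃ dᵃ_k` to the
measurement, where `dᵃ_k = d k y` may depend on the genuine measurement `y` at time `k`. -/
structure AttackInput (n m p' m' : ℕ) where
  Ba : Matrix (Fin n) (Fin p') ℝ
  Da : Matrix (Fin m) (Fin m') ℝ
  ua : ℕ → Vec p'
  d : ℕ → Vec m → Vec m'

/-- The same channels with zero attack inputs: normal operation. -/
def AttackInput.passive {n m p' m' : ℕ} (a : AttackInput n m p' m') : AttackInput n m p' m' where
  Ba := a.Ba
  Da := a.Da
  ua := 0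
  d := 0

noncomputable section

namespace LinearSystem

variable {n p m p' m' : ℕ} (S : LinearSystem n p m)

/-- The innovation covariance `C P Cᵀ + R`. -/
def innovCov (P : Matrix (Fin n) (Fin n) ℝ) : Matrix (Fin m) (Fin m) ℝ :=
  S.C * P * S.Cᵀ + S.R

/-- The Kalman gain `P Cᵀ (C P Cᵀ + R)⁻¹` at prediction error covariance `P`. -/
def gain (P : Matrix (Fin n) (Fin n) ℝ) : Matrix (Fin n) (Fin m) ℝ :=
  P * S.Cᵀ * (S.innovCov P)⁻¹

/-- One step of the Riccati recursion for the prediction error covariance. -/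
def riccatiStep (P : Matrix (Fin n) (Fin n) ℝ) : Matrix (Fin n) (Fin n) ℝ :=
  S.A * P * S.Aᵀ + S.Q - S.A * S.gain P * S.C * P * S.Aᵀ

/-- The prediction error covariances `P_{k|k-1}`, with `P_{0|-1}` given. -/
def errorCov : ℕ → Matrix (Fin n) (Fin n) ℝ
  | 0 => S.P0
  | k + 1 => S.riccatiStep (errorCov k)

/-- The Kalman gains `K_k`. -/
def kalmanGain (k : ℕ) : Matrix (Fin n) (Fin m) ℝ :=
  S.gain (S.errorCov k)

/-- The matrix `(A + B L) (I - K C)`, with `K` the Kalman gain at `P_{0|-1}`. -/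
def feedbackMatrix (L : Matrix (Fin p) (Fin n) ℝ) : Matrix (Fin n) (Fin n) ℝ :=
  (S.A + S.B * L) * (1 - S.gain S.P0 * S.C)

/-- The covariance of `x̂_{k+1|k} = (A + B L) (x̂_{k|k-1} + K (y_k - C x̂_{k|k-1}))` when `x̂_{k|k-1}`
has covariance `W` and the innovation `y_k - C x̂_{k|k-1}`, independent of it, has covariance
`C P Cᵀ + R`, where `P = P_{0|-1}`. -/
def predictionCovStep (L : Matrix (Fin p) (Fin n) ℝ) (W : Matrix (Fin n) (Fin n) ℝ) :
    Matrix (Fin n) (Fin n) ℝ :=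
  (S.A + S.B * L) * (W + S.gain S.P0 * S.innovCov S.P0 * (S.gain S.P0)ᵀ) * (S.A + S.B * L)ᵀ

/-- The state-feedback loop is in steady state, the defender's one-step prediction having
covariance `W`: the prediction error covariance `P_{0|-1}` and `W` are stationary. -/
structure IsSteadyState (L : Matrix (Fin p) (Fin n) ℝ) (W : Matrix (Fin n) (Fin n) ℝ) : Prop where
  posSemidef_errorCov : S.P0.PosSemidef
  riccatiStep_eq : S.riccatiStep S.P0 = S.P0
  posSemidef_predictionCov : W.PosSemidef
  predictionCovStep_eq : S.predictionCovStep L W = W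

/-- The genuine measurement `C x + v_k`. -/
def genuine (ξ : RunNoise n m) (k : ℕ) (x : Vec n) : Vec m :=
  S.C.toEuclideanLin x + ξ.2.2 k

/-- The measurement `C x + v_k + Dᵃ dᵃ_k` that reaches the defender. -/
def received (ξ : RunNoise n m) (a : AttackInput n m p' m') (k : ℕ) (x : Vec n) : Vec m :=
  S.genuine ξ k x + a.Da.toEuclideanLin (a.d k (S.genuine ξ k x))

/-- The measurement update `x̂_{k|k} = (I - K_k C) x̂_{k|k-1} + K_k y_k`. -/
def filtered (k : ℕ) (xh : Vec n) (y : Vec m) : Vec n :=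
  (1 - S.kalmanGain k * S.C).toEuclideanLin xh + (S.kalmanGain k).toEuclideanLin y

/-- The pairs `(x_k, x̂_{k|k-1})` under the state feedback `u_k = L x̂_{k|k}` and the attack `a`, for
a run whose initial prediction is `xh` and whose initial state is `xh + e`. The defender's filter
is fed with the measurements received. -/
def run (L : Matrix (Fin p) (Fin n) ℝ) (xh : Vec n) (ξ : RunNoise n m)
    (a : AttackInput n m p' m') : ℕ → Vec n × Vec n
  | 0 => (xh + ξ.1, xh)
  | k + 1 =>
    let x := (run L xh ξ a k).1
    let xf := S.filtered k (run L xh ξ a k).2 (S.received ξ a k x)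
    let u := L.toEuclideanLin xf
    (S.A.toEuclideanLin x + S.B.toEuclideanLin u + a.Ba.toEuclideanLin (a.ua k) + ξ.2.1 k,
      S.A.toEuclideanLin xf + S.B.toEuclideanLin u)

/-- The defender's output `y_k` in such a run. -/
def output (L : Matrix (Fin p) (Fin n) ℝ) (xh : Vec n) (ξ : RunNoise n m)
    (a : AttackInput n m p' m') (k : ℕ) : Vec m :=
  S.received ξ a k (S.run L xh ξ a k).1

/-- The law of the data of a run: `e ∼ N(0, P_{0|-1})`, and `w_k ∼ N(0, Q)`, `v_k ∼ N(0, R)` i.i.d.,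
all independent. -/
def noiseLaw : Measure (RunNoise n m) :=
  (multivariateGaussian 0 S.P0).prod
    ((Measure.infinitePi fun _ : ℕ => multivariateGaussian 0 S.Q).prod
      (Measure.infinitePi fun _ : ℕ => multivariateGaussian 0 S.R))

/-- The law of the replay experiment: the recorded run starts with a prediction of law `N(0, W)`
and is independent of the run under attack. -/
def sampleLaw (W : Matrix (Fin n) (Fin n) ℝ) : Measure (Sample n m) :=
  S.noiseLaw.prod ((multivariateGaussian 0 W).prod S.noiseLaw)

/-- The output at time `t` of the recorded run. It started at time `-N` and was in normal
operation. -/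
def recordedOutput (L : Matrix (Fin p) (Fin n) ℝ) (N : ℕ) (ω : Sample n m) (t : ℤ) : Vec m :=
  S.output L ω.2.1 ω.2.2 (⟨0, 0, 0, 0⟩ : AttackInput n m 0 0) (t + N).toNat

/-- The replay attack with delay `N`: all sensors are attacked (`Dᵃ = I`), and the genuine
measurement at time `k` is replaced by the output recorded at time `k - N`. Meanwhile arbitrary
inputs `uᵃ_k` are injected through `Bᵃ`. -/
def replayAttack (L : Matrix (Fin p) (Fin n) ℝ) (Ba : Matrix (Fin n) (Fin p') ℝ) (N : ℕ)
    (ua : Sample n m → ℕ → Vec p') (ω : Sample n m) : AttackInput n m p' m where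
  Ba := Ba
  Da := 1
  ua := ua ω
  d k y := S.recordedOutput L N ω (k - N) - y

/-- The joint law of `y_0, …, y_T`, given `x̂_{0|-1}`, under an attack. -/
def outputLaw (L : Matrix (Fin p) (Fin n) ℝ) (W : Matrix (Fin n) (Fin n) ℝ)
    (a : Sample n m → AttackInput n m p' m') (T : ℕ) : Measure (Fin (T + 1) → Vec m) :=
  (S.sampleLaw W).map fun ω k => S.output L S.xhat0 ω.1 (a ω) k

/-- The information flow `IF_T`: the Kullback–Leibler divergence of the law of `y_0, …, y_T` under
attack from their law in normal operation, divided by `T + 1`. -/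
def infoFlow (L : Matrix (Fin p) (Fin n) ℝ) (W : Matrix (Fin n) (Fin n) ℝ)
    (a : Sample n m → AttackInput n m p' m') (T : ℕ) : ℝ≥0∞ :=
  klDiv (S.outputLaw L W a T) (S.outputLaw L W (fun ω => (a ω).passive) T) / (T + 1)

end LinearSystem

end

/-! Put `V = C P Cᵀ + R`. At a fixed point of the Riccati recursion the innovations of a normal run
are i.i.d. `N(0, V)` (`noiseLaw_map_innov`), and the outputs are a causal function of them and of
the first prediction. Under replay the defender sees a normal run whose first prediction is a random
`x ∼ N(0, W)` instead of `x̂_{0|-1}`.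

The key is `prediction_add`: starting from `x` with innovations `z_k` yields the same outputs as
starting from `x̂_{0|-1}` with innovations `z_k + C 𝒜^k (x - x̂_{0|-1})`. Both output laws are
therefore images, under one and the same map, of i.i.d. Gaussians with and without a shift that
depends on an independent `x`.

Keeping `x` as an extra coordinate and applying the data processing inequality bounds the divergence
by that of a Gaussian shift, half the expected squared norm of the whitened shift
(`klDiv_prod_pi_gaussianReal_map_add`). This is at most a constant times `∑_{k ≤ T} ‖V^{-1/2} C
𝒜^k‖²` in Frobenius norm. Stability makes the summands tend to `0`, hence so do their Cesàro means.
-/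

/-! ### Divergence of Gaussian shifts. -/

theorem MeasureTheory.Measure.pi_withDensity {ι : Type*} [Fintype ι] {E : ι → Type*}
    [∀ i, MeasurableSpace (E i)] (μ : ∀ i, Measure (E i)) [∀ i, IsProbabilityMeasure (μ i)]
    {f : ∀ i, E i → ℝ≥0∞} (hf : ∀ i, Measurable (f i))
    [∀ i, SigmaFinite ((μ i).withDensity (f i))] :
    Measure.pi (fun i => (μ i).withDensity (f i)) =
      (Measure.pi μ).withDensity (fun x => ∏ i, f i (x i)) := by
  classical
  refine Measure.pi_eq fun s hs => ?_
  have hind (i) : Measurable ((s i).indicator (f i)) := (hf i).indicator (hs i)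
  have hprod : (Set.univ.pi s).indicator (fun x => ∏ i, f i (x i)) =
      fun x => ∏ i, (s i).indicator (f i) (x i) := by
    ext x
    by_cases hx : x ∈ Set.univ.pi s
    · rw [Set.indicator_of_mem hx]
      exact Finset.prod_congr rfl fun i _ => (Set.indicator_of_mem (hx i trivial) _).symm
    · obtain ⟨i, hi⟩ : ∃ i, x i ∉ s i := by simpa using hx
      rw [Set.indicator_of_notMem hx,
        Finset.prod_eq_zero (Finset.mem_univ i) (Set.indicator_of_notMem hi _)]
  rw [withDensity_apply _ (MeasurableSet.univ_pi hs), ← lintegral_indicator (.univ_pi hs), hprod,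
    lintegral_prod_eq_prod_lintegral_of_indepFun Finset.univ
      (fun i (x : ∀ i, E i) => (s i).indicator (f i) (x i))
      (iIndepFun_pi fun i => (hind i).aemeasurable)
      (fun i => (hind i).comp (measurable_pi_apply i))]
  refine Finset.prod_congr rfl fun i _ => ?_
  rw [withDensity_apply _ (hs i), ← lintegral_indicator (hs i),
    (measurePreserving_eval μ i).lintegral_comp (hind i)]

theorem ProbabilityTheory.gaussianReal_one_eq_withDensity (b : ℝ) :
    gaussianReal b 1 = (gaussianReal 0 1).withDensity
      (fun x => ENNReal.ofReal (Real.exp (b * x - b ^ 2 / 2))) := by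
  rw [gaussianReal_of_var_ne_zero _ one_ne_zero, gaussianReal_of_var_ne_zero _ one_ne_zero,
    ← withDensity_mul _ (by fun_prop) (by fun_prop)]
  congr 1
  ext x
  rw [Pi.mul_apply, gaussianPDF, gaussianPDF, ← ENNReal.ofReal_mul (gaussianPDFReal_nonneg _ _ _)]
  congr 1
  rw [gaussianPDFReal, gaussianPDFReal, mul_assoc _ _ (Real.exp _), ← Real.exp_add]
  congr 2
  norm_num
  ring

theorem ProbabilityTheory.pi_gaussianReal_map_add {ι : Type*} [Fintype ι] (b : ι → ℝ) :
    (Measure.pi fun _ : ι => gaussianReal 0 1).map (fun g => g + b) =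
      (Measure.pi fun _ : ι => gaussianReal 0 1).withDensity
        (fun g => ENNReal.ofReal (Real.exp (∑ i, (b i * g i - b i ^ 2 / 2)))) := by
  have hshift (c : ℝ) : (gaussianReal 0 1).map (fun x => x + c) = gaussianReal c 1 := by
    rw [gaussianReal_map_add_const, zero_add]
  have hprob (c : ℝ) : IsProbabilityMeasure ((gaussianReal 0 1).withDensity
      (fun x => ENNReal.ofReal (Real.exp (c * x - c ^ 2 / 2)))) := by
    rw [← gaussianReal_one_eq_withDensity]; infer_instance
  have h := Measure.pi_map_pi (μ := fun _ : ι => gaussianReal 0 1)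
    (f := fun i (x : ℝ) => x + b i) (fun i => by fun_prop)
  change Measure.map (fun (g : ι → ℝ) i => g i + b i) _ = _
  rw [h]
  simp_rw [hshift]
  rw [show (fun i => gaussianReal (b i) 1) = _ from
      funext fun i => gaussianReal_one_eq_withDensity (b i), Measure.pi_withDensity _ (fun i => by fun_prop)]
  congr 1
  ext g
  rw [Real.exp_sum, ENNReal.ofReal_prod_of_nonneg fun i _ => (Real.exp_pos _).le]

section

variable {X ι : Type*} [MeasurableSpace X] [Fintype ι]

/-- Given the first coordinate the shift is deterministic, so the finite-dimensional Cameron–Martin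
formula applies fibre by fibre. -/
theorem ProbabilityTheory.prod_pi_gaussianReal_map_add (μ : Measure X) [IsProbabilityMeasure μ]
    {b : X → ι → ℝ} (hb : Measurable b) :
    (μ.prod (Measure.pi fun _ : ι => gaussianReal 0 1)).map (fun q => (q.1, q.2 + b q.1)) =
      (μ.prod (Measure.pi fun _ : ι => gaussianReal 0 1)).withDensity
        (fun q => ENNReal.ofReal (Real.exp (∑ i, (b q.1 i * q.2 i - b q.1 i ^ 2 / 2)))) := by
  refine Measure.ext_of_lintegral _ fun φ hφ => ?_
  have hdens : Measurable fun q : X × (ι → ℝ) =>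
      ENNReal.ofReal (Real.exp (∑ i, (b q.1 i * q.2 i - b q.1 i ^ 2 / 2))) := by fun_prop
  rw [lintegral_map hφ (by fun_prop), lintegral_withDensity_eq_lintegral_mul _ hdens hφ,
    lintegral_prod _ (by fun_prop), lintegral_prod _ (by fun_prop)]
  refine lintegral_congr fun x => ?_
  have h := congrArg (fun ν => ∫⁻ g, φ (x, g) ∂ν) (pi_gaussianReal_map_add (b x))
  simp only at h
  rw [lintegral_map (by fun_prop) (by fun_prop),
    lintegral_withDensity_eq_lintegral_mul _ (by fun_prop) (by fun_prop)] at h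
  exact h

theorem InformationTheory.klDiv_withDensity_exp (ν : Measure X) [IsProbabilityMeasure ν]
    {φ : X → ℝ} (hφ : Measurable φ)
    (hprob : IsProbabilityMeasure (ν.withDensity fun x => ENNReal.ofReal (Real.exp (φ x))))
    (hint : Integrable φ (ν.withDensity fun x => ENNReal.ofReal (Real.exp (φ x)))) :
    klDiv (ν.withDensity fun x => ENNReal.ofReal (Real.exp (φ x))) ν =
      ENNReal.ofReal (∫ x, φ x ∂(ν.withDensity fun x => ENNReal.ofReal (Real.exp (φ x)))) := by
  set μ := ν.withDensity fun x => ENNReal.ofReal (Real.exp (φ x)) with hμ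
  have hac : μ ≪ ν := withDensity_absolutelyContinuous _ _
  have hllr : llr μ ν =ᵐ[μ] φ := by
    refine hac.ae_le ?_
    filter_upwards [ν.rnDeriv_withDensity (f := fun x => ENNReal.ofReal (Real.exp (φ x)))
      (by fun_prop)] with x hx
    rw [llr, hμ, hx, ENNReal.toReal_ofReal (Real.exp_pos _).le, Real.log_exp]
  rw [klDiv_of_ac_of_integrable hac ((integrable_congr hllr).2 hint), integral_congr_ae hllr]
  simp

/-- Under the shifted law the log-density becomes `∑ (b g + b² / 2)`. The cross terms integrate to
zero because `g` is centred and independent of `b`. -/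
theorem InformationTheory.klDiv_prod_pi_gaussianReal_map_add (μ : Measure X)
    [IsProbabilityMeasure μ] {b : X → ι → ℝ} (hb : Measurable b)
    (hb2 : ∀ i, MemLp (fun x => b x i) 2 μ) :
    klDiv ((μ.prod (Measure.pi fun _ : ι => gaussianReal 0 1)).map
        (fun q => (q.1, q.2 + b q.1))) (μ.prod (Measure.pi fun _ : ι => gaussianReal 0 1)) =
      ENNReal.ofReal (∫ x, ∑ i, b x i ^ 2 / 2 ∂μ) := by
  set γ : Measure (ι → ℝ) := Measure.pi fun _ : ι => gaussianReal 0 1 with hγ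
  have hφ : Measurable fun q : X × (ι → ℝ) => ∑ i, (b q.1 i * q.2 i - b q.1 i ^ 2 / 2) := by
    fun_prop
  have hshift : Measurable fun q : X × (ι → ℝ) => (q.1, q.2 + b q.1) := by fun_prop
  have hsq (i) : Integrable (fun q : X × (ι → ℝ) => b q.1 i ^ 2 / 2) (μ.prod γ) :=
    ((hb2 i).integrable_sq.div_const 2).comp_fst γ
  have hid (i) : Integrable (fun g : ι → ℝ => g i) γ :=
    integrable_eval (μ := fun _ : ι => gaussianReal 0 1) IsGaussian.integrable_id
  have hcross (i) : Integrable (fun q : X × (ι → ℝ) => b q.1 i * q.2 i) (μ.prod γ) :=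
    ((hb2 i).integrable (by norm_num)).mul_prod (hid i)
  have hzero (i) : ∫ q : X × (ι → ℝ), b q.1 i * q.2 i ∂(μ.prod γ) = 0 := by
    rw [integral_prod_mul (fun x => b x i) (fun g : ι → ℝ => g i), hγ]
    have := integral_eval (μ := fun _ : ι => gaussianReal 0 1) (i := i)
    simp_all
  have hexp : (fun q : X × (ι → ℝ) => ∑ i, (b q.1 i * (q.2 + b q.1) i - b q.1 i ^ 2 / 2)) =
      fun q => ∑ i, (b q.1 i * q.2 i + b q.1 i ^ 2 / 2) := by
    ext q
    refine Finset.sum_congr rfl fun i _ => ?_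
    rw [Pi.add_apply]; ring
  have hint : Integrable (fun q : X × (ι → ℝ) => ∑ i, (b q.1 i * q.2 i - b q.1 i ^ 2 / 2))
      ((μ.prod γ).map (fun q => (q.1, q.2 + b q.1))) := by
    rw [integrable_map_measure hφ.aestronglyMeasurable hshift.aemeasurable]
    change Integrable (fun q : X × (ι → ℝ) =>
      ∑ i, (b q.1 i * (q.2 + b q.1) i - b q.1 i ^ 2 / 2)) _
    rw [hexp]
    exact integrable_finsetSum _ fun i _ => (hcross i).add (hsq i)
  have hprob : IsProbabilityMeasure ((μ.prod γ).map (fun q => (q.1, q.2 + b q.1))) :=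
    Measure.isProbabilityMeasure_map hshift.aemeasurable
  have hval : ∫ q, ∑ i, (b q.1 i * q.2 i - b q.1 i ^ 2 / 2)
      ∂((μ.prod γ).map (fun q => (q.1, q.2 + b q.1))) = ∫ x, ∑ i, b x i ^ 2 / 2 ∂μ := by
    rw [integral_map hshift.aemeasurable hφ.aestronglyMeasurable]
    change ∫ q : X × (ι → ℝ), ∑ i, (b q.1 i * (q.2 + b q.1) i - b q.1 i ^ 2 / 2) ∂_ = _
    rw [hexp, integral_finsetSum (f := fun i (q : X × (ι → ℝ)) => b q.1 i * q.2 i + b q.1 i ^ 2 / 2) _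
        fun i _ => (hcross i).add (hsq i),
      integral_finsetSum _ fun i _ => (hb2 i).integrable_sq.div_const 2]
    refine Finset.sum_congr rfl fun i _ => ?_
    rw [integral_add (hcross i) (hsq i), hzero, zero_add,
      integral_fun_fst (μ := μ) (ν := γ) (fun x => b x i ^ 2 / 2)]
    simp
  rw [← hval]
  rw [prod_pi_gaussianReal_map_add μ hb] at hprob hint ⊢
  exact klDiv_withDensity_exp _ hφ hprob hint

end

/-! ### Splitting off the first term of an i.i.d. sequence. -/

theorem measurable_natCasesOn (X : Type*) [MeasurableSpace X] :
    Measurable fun q : X × (ℕ → X) => fun k : ℕ => (k.casesOn q.1 q.2 : X) := by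
  refine measurable_pi_lambda _ fun k => ?_
  cases k with
  | zero => exact measurable_fst
  | succ k => exact (measurable_pi_apply k).comp measurable_snd

theorem MeasureTheory.Measure.prod_infinitePi_map_cons {X : Type*} [MeasurableSpace X]
    (μ : Measure X) [IsProbabilityMeasure μ] :
    (μ.prod (Measure.infinitePi fun _ : ℕ => μ)).map
        (fun q => fun k : ℕ => k.casesOn q.1 q.2) = Measure.infinitePi fun _ : ℕ => μ := by
  classical
  refine Measure.eq_infinitePi _ fun s t ht => ?_
  have hmeas := measurable_natCasesOn X
  obtain ⟨N, hN⟩ : ∃ N, s ⊆ Finset.range (N + 1) :=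
    ⟨s.sup id, fun k hk => Finset.mem_range_succ_iff.2 (Finset.le_sup (f := id) hk)⟩
  -- Padding with `univ` turns a cylinder over `s` into one over an initial segment, which splits
  -- into a condition on the head and a cylinder on the tail.
  let t' : ℕ → Set X := fun k => if k ∈ s then t k else Set.univ
  have ht' (k) : MeasurableSet (t' k) := by
    by_cases hk : k ∈ s <;> simp [t', hk, ht k]
  have hpre : (fun q : X × (ℕ → X) => fun k : ℕ => (k.casesOn q.1 q.2 : X)) ⁻¹'
      (Set.pi s t) = t' 0 ×ˢ Set.pi (Finset.range N) (fun k => t' (k + 1)) := by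
    ext q
    simp only [Set.mem_preimage, Set.mem_pi, Set.mem_prod, Finset.mem_coe, Finset.mem_range, t']
    constructor
    · intro h
      refine ⟨?_, fun k _ => ?_⟩
      · split_ifs with h0
        exacts [h 0 h0, trivial]
      · split_ifs with h0
        exacts [h (k + 1) h0, trivial]
    · rintro ⟨h0, h1⟩ k hk
      cases k with
      | zero => simpa [hk] using h0
      | succ k =>
        have := h1 k (by have := Finset.mem_range.1 (hN hk); omega)
        simpa [hk] using this
  have hsub : ∏ k ∈ s, μ (t k) = ∏ k ∈ Finset.range (N + 1), μ (t' k) := by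
    rw [← Finset.prod_subset hN fun k _ hk => by simp [t', hk]]
    exact Finset.prod_congr rfl fun k hk => by simp [t', hk]
  rw [Measure.map_apply hmeas (.pi s.countable_toSet fun k _ => ht k), hpre, Measure.prod_prod,
    Measure.infinitePi_pi _ fun k _ => ht' (k + 1), hsub, Finset.prod_range_succ', mul_comm]

theorem MeasureTheory.Measure.prod_rearrange {X₁ X₂ X₃ X₄ X₅ : Type*} [MeasurableSpace X₁]
    [MeasurableSpace X₂] [MeasurableSpace X₃] [MeasurableSpace X₄] [MeasurableSpace X₅]
    (μ₁ : Measure X₁) (μ₂ : Measure X₂) (μ₃ : Measure X₃) (μ₄ : Measure X₄) (μ₅ : Measure X₅)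
    [SFinite μ₁] [SFinite μ₂] [SFinite μ₃] [SFinite μ₄] [SFinite μ₅] :
    ((μ₁.prod (μ₂.prod μ₃)).prod (μ₄.prod μ₅)).map
        (fun q => (q.1.1, ((q.1.2.1, q.2.1), (q.1.2.2, q.2.2)))) =
      μ₁.prod ((μ₂.prod μ₄).prod (μ₃.prod μ₅)) := by
  refine Measure.ext_of_lintegral _ fun φ hφ => ?_
  rw [lintegral_map hφ (by fun_prop), lintegral_prod _ (by fun_prop),
    lintegral_prod _ (by fun_prop), lintegral_prod _ (by fun_prop)]
  refine lintegral_congr fun x => ?_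
  rw [lintegral_prod _ (by fun_prop), lintegral_prod _ (by fun_prop),
    lintegral_prod _ (by fun_prop)]
  refine lintegral_congr fun y => ?_
  trans ∫⁻ z, ∫⁻ x₄, ∫⁻ x₅, φ (x, ((y, x₄), (z, x₅))) ∂μ₅ ∂μ₄ ∂μ₃
  · exact lintegral_congr fun z => lintegral_prod _ (by fun_prop)
  · rw [lintegral_lintegral_swap (Measurable.aemeasurable (by fun_prop))]
    refine lintegral_congr fun z => Eq.symm ?_
    exact lintegral_prod _ (by fun_prop)

/-! ### Law of the steady-state innovations. -/

noncomputable section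

namespace LinearSystem

variable {n p m p' m' : ℕ} (S : LinearSystem n p m)

/-- The prediction errors `x_k - x̂_{k|k-1}` when the Kalman gain is constant. -/
def predErr (e : Vec n) (w : ℕ → Vec n) (v : ℕ → Vec m) : ℕ → Vec n
  | 0 => e
  | k + 1 => S.A.toEuclideanLin (predErr e w v k - (S.gain S.P0).toEuclideanLin
      (S.C.toEuclideanLin (predErr e w v k) + v k)) + w k

/-- The innovations `y_k - C x̂_{k|k-1}` when the Kalman gain is constant. -/
def innov (e : Vec n) (w : ℕ → Vec n) (v : ℕ → Vec m) (k : ℕ) : Vec m :=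
  S.C.toEuclideanLin (S.predErr e w v k) + v k

theorem measurable_predErr (k : ℕ) :
    Measurable fun ξ : RunNoise n m => S.predErr ξ.1 ξ.2.1 ξ.2.2 k := by
  have hlin {a b : ℕ} (M : Matrix (Fin a) (Fin b) ℝ) : Measurable (M.toEuclideanLin) :=
    (LinearMap.continuous_of_finiteDimensional _).measurable
  induction k with
  | zero => exact measurable_fst
  | succ k ih =>
    simp only [predErr]
    exact ((hlin _).comp (ih.sub ((hlin _).comp (((hlin _).comp ih).add (by fun_prop))))).add
      (by fun_prop)

theorem measurable_innov (k : ℕ) :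
    Measurable fun ξ : RunNoise n m => S.innov ξ.1 ξ.2.1 ξ.2.2 k := by
  have hlin {a b : ℕ} (M : Matrix (Fin a) (Fin b) ℝ) : Measurable (M.toEuclideanLin) :=
    (LinearMap.continuous_of_finiteDimensional _).measurable
  exact ((hlin _).comp (S.measurable_predErr k)).add (by fun_prop)

/-- One step of the innovation recursion: the innovation and the next prediction error, as a
function of the prediction error, the process noise and the measurement noise. -/
def innovStep (q : Vec n × Vec n × Vec m) : Vec m × Vec n :=
  (S.C.toEuclideanLin q.1 + q.2.2,
    S.A.toEuclideanLin (q.1 - (S.gain S.P0).toEuclideanLin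
      (S.C.toEuclideanLin q.1 + q.2.2)) + q.2.1)

theorem measurable_innovStep : Measurable S.innovStep := by
  have hlin {a b : ℕ} (M : Matrix (Fin a) (Fin b) ℝ) : Measurable (M.toEuclideanLin) :=
    (LinearMap.continuous_of_finiteDimensional _).measurable
  unfold innovStep
  exact (((hlin _).comp measurable_fst).add (by fun_prop)).prodMk
    (((hlin _).comp (measurable_fst.sub ((hlin _).comp
      (((hlin _).comp measurable_fst).add (by fun_prop))))).add (by fun_prop))

/-- Covariance form of one filter step: `(t, r, u)` is the adjoint of `innovStep` applied to `(s,
r)`. The right side has no term mixing `s` and `r`, which is the orthogonality of the innovation and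
the next error; it comes from the gain identity `V Kᵀ = C P`. -/
theorem quadratic_innovStep (hP : S.P0ᵀ = S.P0) (hR : S.Rᵀ = S.R)
    (hunit : IsUnit (S.innovCov S.P0).det) (hric : S.riccatiStep S.P0 = S.P0)
    (s : Fin m → ℝ) (r : Fin n → ℝ) :
    let u := s - (S.gain S.P0)ᵀ *ᵥ S.Aᵀ *ᵥ r
    let t := S.Cᵀ *ᵥ u + S.Aᵀ *ᵥ r
    t ⬝ᵥ S.P0 *ᵥ t + r ⬝ᵥ S.Q *ᵥ r + u ⬝ᵥ S.R *ᵥ u =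
      s ⬝ᵥ S.innovCov S.P0 *ᵥ s + r ⬝ᵥ S.P0 *ᵥ r := by
  intro u t
  set a := S.Aᵀ *ᵥ r with ha
  set κ := (S.gain S.P0)ᵀ *ᵥ a with hκ
  set V := S.innovCov S.P0 with hV
  have hVT : Vᵀ = V := by
    simp [hV, innovCov, Matrix.transpose_mul, Matrix.mul_assoc, hP, hR]
  have hgain : V * (S.gain S.P0)ᵀ = S.C * S.P0 := by
    rw [gain, Matrix.transpose_mul, Matrix.transpose_mul, Matrix.transpose_nonsing_inv, ← hV, hVT,
      Matrix.transpose_transpose, hP, ← Matrix.mul_assoc, Matrix.mul_nonsing_inv _ hunit,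
      Matrix.one_mul]
  have hVκ : V *ᵥ κ = S.C *ᵥ S.P0 *ᵥ a := by
    rw [hκ, Matrix.mulVec_mulVec, hgain, ← Matrix.mulVec_mulVec]
  have hadj {i j : ℕ} (M : Matrix (Fin i) (Fin j) ℝ) (x : Fin i → ℝ) (y : Fin j → ℝ) :
      (Mᵀ *ᵥ x) ⬝ᵥ y = x ⬝ᵥ M *ᵥ y := by
    rw [Matrix.mulVec_transpose, Matrix.dotProduct_mulVec]
  have hsymm (M : Matrix (Fin n) (Fin n) ℝ) (hM : Mᵀ = M) (x y) :
      x ⬝ᵥ M *ᵥ y = y ⬝ᵥ M *ᵥ x := by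
    rw [← hadj, hM, dotProduct_comm]
  have hsymm' (x y) : x ⬝ᵥ V *ᵥ y = y ⬝ᵥ V *ᵥ x := by
    rw [← hadj, hVT, dotProduct_comm]
  have h1 : (S.Cᵀ *ᵥ u) ⬝ᵥ S.P0 *ᵥ (S.Cᵀ *ᵥ u) + u ⬝ᵥ S.R *ᵥ u = u ⬝ᵥ V *ᵥ u := by
    rw [hadj, hV, innovCov, Matrix.add_mulVec, dotProduct_add, ← Matrix.mulVec_mulVec,
      ← Matrix.mulVec_mulVec]
  -- The fixed-point equation enters here: it makes the next error have covariance `P` again.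
  have h2 : r ⬝ᵥ S.P0 *ᵥ r = a ⬝ᵥ S.P0 *ᵥ a + r ⬝ᵥ S.Q *ᵥ r - κ ⬝ᵥ S.C *ᵥ S.P0 *ᵥ a := by
    conv_lhs => rw [← hric, riccatiStep]
    simp only [Matrix.sub_mulVec, Matrix.add_mulVec, dotProduct_sub, dotProduct_add,
      ← Matrix.mulVec_mulVec, ← ha, hκ]
    rw [hadj (S.gain S.P0), ← hadj S.A, ← hadj S.A, ← ha]
  have h3 : (S.Cᵀ *ᵥ u) ⬝ᵥ S.P0 *ᵥ a = s ⬝ᵥ S.C *ᵥ S.P0 *ᵥ a - κ ⬝ᵥ S.C *ᵥ S.P0 *ᵥ a := by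
    rw [hadj, sub_dotProduct]
  have h4 : u ⬝ᵥ V *ᵥ u =
      s ⬝ᵥ V *ᵥ s - 2 * s ⬝ᵥ S.C *ᵥ S.P0 *ᵥ a + κ ⬝ᵥ S.C *ᵥ S.P0 *ᵥ a := by
    have : u = s - κ := rfl
    rw [this, Matrix.mulVec_sub, dotProduct_sub, sub_dotProduct, sub_dotProduct, hsymm' κ s, hVκ]
    ring
  have h5 : t ⬝ᵥ S.P0 *ᵥ t = (S.Cᵀ *ᵥ u) ⬝ᵥ S.P0 *ᵥ (S.Cᵀ *ᵥ u) +
      2 * (S.Cᵀ *ᵥ u) ⬝ᵥ S.P0 *ᵥ a + a ⬝ᵥ S.P0 *ᵥ a := by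
    have : t = S.Cᵀ *ᵥ u + a := rfl
    rw [this, Matrix.mulVec_add, dotProduct_add, add_dotProduct, add_dotProduct,
      hsymm _ hP a (S.Cᵀ *ᵥ u)]
    ring
  linarith

/-- The exponent of the joint characteristic function is a quadratic form without cross terms, so
the function factors, and this gives independence. -/
theorem map_innovStep (hQ : S.Q.PosSemidef) (hR : S.R.PosSemidef)
    (hP : S.P0.PosSemidef) (hric : S.riccatiStep S.P0 = S.P0)
    (hinnov : (S.innovCov S.P0).PosDef) :
    ((multivariateGaussian 0 S.P0).prod
        ((multivariateGaussian 0 S.Q).prod (multivariateGaussian 0 S.R))).map S.innovStep =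
      (multivariateGaussian 0 (S.innovCov S.P0)).prod (multivariateGaussian 0 S.P0) := by
  have hmeas := S.measurable_innovStep
  have : IsProbabilityMeasure (((multivariateGaussian 0 S.P0).prod
        ((multivariateGaussian 0 S.Q).prod (multivariateGaussian 0 S.R))).map S.innovStep) :=
    Measure.isProbabilityMeasure_map hmeas.aemeasurable
  rw [← charFun_eq_prod_iff]
  intro t
  set s := (WithLp.ofLp t).1
  set r := (WithLp.ofLp t).2
  set u : Vec m := WithLp.toLp 2 ((s : Fin m → ℝ) - (S.gain S.P0)ᵀ *ᵥ S.Aᵀ *ᵥ (r : Fin n → ℝ))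
  set t' : Vec n := WithLp.toLp 2 (S.Cᵀ *ᵥ (u : Fin m → ℝ) + S.Aᵀ *ᵥ (r : Fin n → ℝ))
  have hinner (q : Vec n × Vec n × Vec m) :
      inner ℝ (WithLp.toLp 2 (S.innovStep q)) t =
        inner ℝ q.1 t' + (inner ℝ q.2.1 r + inner ℝ q.2.2 u) := by
    have hadj {i j : ℕ} (M : Matrix (Fin i) (Fin j) ℝ) (x : Fin i → ℝ) (y : Fin j → ℝ) :
        (Mᵀ *ᵥ x) ⬝ᵥ y = x ⬝ᵥ M *ᵥ y := by
      rw [Matrix.mulVec_transpose, Matrix.dotProduct_mulVec]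
    rw [WithLp.prod_inner_apply]
    simp only [innovStep, EuclideanSpace.inner_eq_star_dotProduct, star_trivial, t', u,
      WithLp.ofLp_add, WithLp.ofLp_sub, Matrix.ofLp_toLpLin, Matrix.toLin'_apply, add_dotProduct,
      sub_dotProduct, dotProduct_add, dotProduct_sub, hadj, Matrix.mulVec_add, Matrix.mulVec_sub,
      s, r]
    ring
  have hfun : charFun ((((multivariateGaussian 0 S.P0).prod
      ((multivariateGaussian 0 S.Q).prod (multivariateGaussian 0 S.R))).map S.innovStep).map
        (WithLp.toLp 2)) t =
      charFun (multivariateGaussian 0 S.P0) t' *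
        (charFun (multivariateGaussian 0 S.Q) r * charFun (multivariateGaussian 0 S.R) u) := by
    simp_rw [charFun_apply]
    rw [← MeasurableEquiv.coe_toLp, integral_map_equiv, integral_map hmeas.aemeasurable
      (by fun_prop), ← integral_prod_mul, ← integral_prod_mul]
    refine integral_congr_ae (.of_forall fun q => ?_)
    simp only [MeasurableEquiv.coe_toLp, hinner]
    rw [← Complex.exp_add, ← Complex.exp_add]
    congr 1
    push_cast
    ring
  rw [hfun, charFun_multivariateGaussian hP, charFun_multivariateGaussian hQ,
    charFun_multivariateGaussian hR, charFun_multivariateGaussian hP,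
    charFun_multivariateGaussian hinnov.posSemidef, ← Complex.exp_add, ← Complex.exp_add,
    ← Complex.exp_add]
  congr 1
  have hquad := S.quadratic_innovStep (by simpa using hP.isHermitian.eq)
    (by simpa using hR.isHermitian.eq) hinnov.det_pos.ne'.isUnit hric s r
  have hquad' := congrArg (fun x : ℝ => (x : ℂ)) hquad
  simp only [Complex.ofReal_add] at hquad'
  simp only [inner_zero_right, Complex.ofReal_zero, zero_mul, zero_sub]
  linear_combination (-1 / 2 : ℂ) * hquad'

theorem predErr_casesOn (e w₀ : Vec n) (v₀ : Vec m) (w : ℕ → Vec n) (v : ℕ → Vec m) (k : ℕ) :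
    S.predErr e (fun k => k.casesOn w₀ w) (fun k => k.casesOn v₀ v) (k + 1) =
      S.predErr (S.innovStep (e, w₀, v₀)).2 w v k := by
  induction k with
  | zero => rfl
  | succ k ih => rw [predErr, ih]; rfl

theorem innov_casesOn (e w₀ : Vec n) (v₀ : Vec m) (w : ℕ → Vec n) (v : ℕ → Vec m) (k : ℕ) :
    S.innov e (fun k => k.casesOn w₀ w) (fun k => k.casesOn v₀ v) (k + 1) =
      S.innov (S.innovStep (e, w₀, v₀)).2 w v k := by
  rw [innov, predErr_casesOn]; rfl

theorem noiseLaw_eq_map : S.noiseLaw =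
    (((multivariateGaussian 0 S.P0).prod
        ((multivariateGaussian 0 S.Q).prod (multivariateGaussian 0 S.R))).prod
      ((Measure.infinitePi fun _ : ℕ => multivariateGaussian 0 S.Q).prod
        (Measure.infinitePi fun _ : ℕ => multivariateGaussian 0 S.R))).map
      (fun q => (q.1.1, (fun k : ℕ => (k.casesOn q.1.2.1 q.2.1 : Vec n)),
        (fun k : ℕ => (k.casesOn q.1.2.2 q.2.2 : Vec m)))) := by
  have hmeas (d : ℕ) := measurable_natCasesOn (Vec d)
  rw [noiseLaw]
  conv_lhs =>
    rw [← Measure.prod_infinitePi_map_cons (multivariateGaussian 0 S.Q),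
      ← Measure.prod_infinitePi_map_cons (multivariateGaussian 0 S.R),
      Measure.map_prod_map _ _ (hmeas n) (hmeas m),
      ← Measure.map_id (μ := multivariateGaussian 0 S.P0),
      Measure.map_prod_map _ _ measurable_id ((hmeas n).prodMap (hmeas m)),
      ← Measure.prod_rearrange, Measure.map_map
        (measurable_id.prodMap ((hmeas n).prodMap (hmeas m))) (by fun_prop)]
  rfl

/-- The innovations are independent and have law `N(0, C P Cᵀ + R)`. -/
theorem noiseLaw_map_innov (hQ : S.Q.PosSemidef) (hR : S.R.PosSemidef)
    (hP : S.P0.PosSemidef) (hric : S.riccatiStep S.P0 = S.P0)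
    (hinnov : (S.innovCov S.P0).PosDef) (T : ℕ) :
    S.noiseLaw.map (fun ξ (k : Fin T) => S.innov ξ.1 ξ.2.1 ξ.2.2 k) =
      Measure.pi fun _ : Fin T => multivariateGaussian 0 (S.innovCov S.P0) := by
  have : IsProbabilityMeasure S.noiseLaw := by unfold noiseLaw; infer_instance
  have hmeas (T : ℕ) : Measurable
      fun (ξ : RunNoise n m) (k : Fin T) => S.innov ξ.1 ξ.2.1 ξ.2.2 k :=
    measurable_pi_lambda _ fun k => S.measurable_innov k
  induction T with
  | zero =>
    refine (Measure.pi_eq fun s _ => ?_).symm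
    have : IsProbabilityMeasure (S.noiseLaw.map
        fun ξ (k : Fin 0) => S.innov ξ.1 ξ.2.1 ξ.2.2 k) :=
      Measure.isProbabilityMeasure_map (hmeas 0).aemeasurable
    rw [Set.eq_univ_of_forall (s := Set.univ.pi s) fun x i => i.elim0, measure_univ]
    simp
  | succ T ih =>
    have hcons := measurePreserving_piFinSuccAbove
      (fun _ : Fin (T + 1) => multivariateGaussian (0 : Vec m) (S.innovCov S.P0)) 0
    -- After one step the new error is again `N(0, P)` and independent of the first innovation and
    -- of all later noise. The remaining innovations thus see a fresh copy of `noiseLaw`, to which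
    -- the induction hypothesis applies.
    have hstep : MeasurePreserving S.innovStep _ _ :=
      ⟨S.measurable_innovStep, S.map_innovStep hQ hR hP hric hinnov⟩
    have hrest : MeasurePreserving _ S.noiseLaw _ := ⟨hmeas T, ih⟩
    have h := hcons.symm.comp (((MeasurePreserving.id _).prod hrest).comp
      ((measurePreserving_prodAssoc _ _ _).comp (hstep.prod (MeasurePreserving.id
        ((Measure.infinitePi fun _ : ℕ => multivariateGaussian 0 S.Q).prod
          (Measure.infinitePi fun _ : ℕ => multivariateGaussian 0 S.R))))))
    rw [noiseLaw_eq_map, Measure.map_map (hmeas _)]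
    · rw [← h.map_eq]
      congr 1
      ext q k : 2
      refine Fin.cases ?_ (fun k => ?_) k
      · rfl
      · exact S.innov_casesOn q.1.1 q.1.2.1 q.1.2.2 q.2.1 q.2.2 k
    · exact Measurable.prodMk (by fun_prop) (((measurable_natCasesOn (Vec n)).comp
        (by fun_prop : Measurable fun q : (Vec n × Vec n × Vec m) × ((ℕ → Vec n) × (ℕ → Vec m)) =>
          (q.1.2.1, q.2.1))).prodMk ((measurable_natCasesOn (Vec m)).comp (by fun_prop :
        Measurable fun q : (Vec n × Vec n × Vec m) × ((ℕ → Vec n) × (ℕ → Vec m)) =>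
          (q.1.2.2, q.2.2))))

end LinearSystem
end

/-! ### Powers of a stable matrix. -/

/-- By Gelfand's formula `‖G ^ k‖` is eventually at most `r ^ k` for any `r < 1` above the spectral
radius. -/
theorem Matrix.tendsto_pow_apply_of_spectralRadius_lt_one {n : ℕ}
    (F : Matrix (Fin n) (Fin n) ℝ)
    (hF : spectralRadius ℂ (F.map (algebraMap ℝ ℂ)) < 1) (i j : Fin n) :
    Tendsto (fun k => (F ^ k) i j) atTop (𝓝 0) := by
  let _ : NormedRing (Matrix (Fin n) (Fin n) ℂ) := Matrix.linftyOpNormedRing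
  let _ : NormedAlgebra ℂ (Matrix (Fin n) (Fin n) ℂ) := Matrix.linftyOpNormedAlgebra
  set G := F.map (algebraMap ℝ ℂ) with hG
  obtain ⟨r, hr, hr1⟩ := exists_between hF
  have hev : ∀ᶠ k : ℕ in atTop, ENNReal.ofReal (‖G ^ k‖ ^ (1 / k : ℝ)) < r :=
    (spectrum.pow_norm_pow_one_div_tendsto_nhds_spectralRadius G).eventually_lt_const hr
  have hrtop : r ≠ ∞ := (hr1.trans ENNReal.one_lt_top).ne
  have hr1' : r.toReal < 1 := by simpa using (ENNReal.toReal_lt_toReal hrtop ENNReal.one_ne_top).2 hr1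
  have hentry (M : Matrix (Fin n) (Fin n) ℂ) : ‖M i j‖ ≤ ‖M‖ := by
    rw [Matrix.linfty_opNorm_def]
    have h1 : ‖M i j‖₊ ≤ ∑ j, ‖M i j‖₊ :=
      Finset.single_le_sum (f := fun j => ‖M i j‖₊) (fun _ _ => zero_le) (Finset.mem_univ j)
    have h2 := Finset.le_sup (f := fun i => ∑ j, ‖M i j‖₊) (Finset.mem_univ i)
    exact_mod_cast h1.trans h2
  refine squeeze_zero_norm' ?_ (tendsto_pow_atTop_nhds_zero_of_lt_one ENNReal.toReal_nonneg hr1')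
  filter_upwards [hev, eventually_gt_atTop 0] with k hk hk0
  have hmap : (F ^ k).map (algebraMap ℝ ℂ) = G ^ k := by
    exact map_pow (algebraMap ℝ ℂ).mapMatrix F k
  have h1 : ‖(F ^ k) i j‖ ≤ ‖G ^ k‖ := by
    refine le_trans (le_of_eq ?_) (hentry (G ^ k))
    rw [← hmap]; simp
  refine h1.trans ?_
  have h2 : ‖G ^ k‖ ^ (1 / k : ℝ) ≤ r.toReal :=
    (ENNReal.ofReal_le_iff_le_toReal hrtop).1 hk.le
  calc ‖G ^ k‖ = (‖G ^ k‖ ^ (1 / k : ℝ)) ^ k := by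
        rw [one_div, Real.rpow_inv_natCast_pow (norm_nonneg _) hk0.ne']
    _ ≤ r.toReal ^ k := pow_le_pow_left₀ (by positivity) h2 k

/-! ### The closed loop driven by its innovations. -/

noncomputable section

namespace LinearSystem

variable {n p m p' m' : ℕ} (S : LinearSystem n p m) (L : Matrix (Fin p) (Fin n) ℝ)

theorem errorCov_eq (hric : S.riccatiStep S.P0 = S.P0) (k : ℕ) : S.errorCov k = S.P0 := by
  induction k with
  | zero => rfl
  | succ k ih => rw [errorCov, ih, hric]

/-- The one-step predictions `x̂_{k|k-1}` as a function of the first one and of the innovations,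
when the Kalman gain is constant. -/
def prediction (x : Vec n) (z : ℕ → Vec m) : ℕ → Vec n
  | 0 => x
  | k + 1 => (S.A + S.B * L).toEuclideanLin
      (prediction x z k + (S.gain S.P0).toEuclideanLin (z k))

/-- The control term enters state and prediction alike and cancels in their difference, so the error
evolves independently of the feedback and of the first prediction. -/
theorem run_eq (hric : S.riccatiStep S.P0 = S.P0) (x : Vec n) (ξ : RunNoise n m)
    (a : AttackInput n m p' m') (hua : ∀ k, a.ua k = 0) (hd : ∀ k y, a.d k y = 0) (k : ℕ) :
    S.run L x ξ a k =
      (S.prediction L x (S.innov ξ.1 ξ.2.1 ξ.2.2) k + S.predErr ξ.1 ξ.2.1 ξ.2.2 k,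
        S.prediction L x (S.innov ξ.1 ξ.2.1 ξ.2.2) k) := by
  induction k with
  | zero => rfl
  | succ k ih =>
    simp only [run, ih, prediction, predErr, received, genuine, filtered, kalmanGain,
      S.errorCov_eq hric, hua, hd, innov, map_add, map_sub, map_zero, LinearMap.add_apply,
      LinearMap.sub_apply, Matrix.toLpLin_mul_same, Matrix.toLpLin_one, LinearMap.comp_apply,
      LinearMap.id_apply, add_zero]
    refine Prod.ext ?_ ?_
    · simp only
      abel
    · simp only
      abel

theorem output_eq (hric : S.riccatiStep S.P0 = S.P0) (x : Vec n) (ξ : RunNoise n m)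
    (a : AttackInput n m p' m') (hua : ∀ k, a.ua k = 0) (hd : ∀ k y, a.d k y = 0) (k : ℕ) :
    S.output L x ξ a k = S.innov ξ.1 ξ.2.1 ξ.2.2 k +
      S.C.toEuclideanLin (S.prediction L x (S.innov ξ.1 ξ.2.1 ξ.2.2) k) := by
  simp only [output, S.run_eq L hric x ξ a hua hd, received, genuine, hd, innov, map_add, map_zero]
  abel

/-- The genuine measurement cancels, and with it the attacked state and the injected inputs. Since
`(k - N) + N = k`, the delay disappears too. -/
theorem output_replayAttack (Ba : Matrix (Fin n) (Fin p') ℝ) (N : ℕ)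
    (ua : Sample n m → ℕ → Vec p') (ω : Sample n m) (k : ℕ) :
    S.output L S.xhat0 ω.1 (S.replayAttack L Ba N ua ω) k =
      S.output L ω.2.1 ω.2.2 (⟨0, 0, 0, 0⟩ : AttackInput n m 0 0) k := by
  simp [output, received, replayAttack, recordedOutput, Matrix.toLpLin_one]

/-- The innovations are altered exactly so that both filters receive the same outputs. The
difference of two predictions fed with equal outputs is multiplied by `(A + B L) (I - K C)` at each
step. -/
theorem prediction_add (x d : Vec n) (z : ℕ → Vec m) (k : ℕ) :
    S.prediction L (x + d) z k = S.prediction L x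
      (fun k => z k + S.C.toEuclideanLin ((S.feedbackMatrix L ^ k).toEuclideanLin d)) k +
        (S.feedbackMatrix L ^ k).toEuclideanLin d := by
  induction k with
  | zero => simp [prediction, Matrix.toLpLin_one]
  | succ k ih =>
    have hstep (y : Vec n) : (S.feedbackMatrix L).toEuclideanLin y =
        (S.A + S.B * L).toEuclideanLin (y - (S.gain S.P0).toEuclideanLin
          (S.C.toEuclideanLin y)) := by
      simp only [feedbackMatrix, map_sub, LinearMap.sub_apply, Matrix.toLpLin_mul_same,
        Matrix.toLpLin_one, LinearMap.comp_apply, LinearMap.id_apply]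
    rw [prediction, prediction, ih, pow_succ', Matrix.toLpLin_mul_same, LinearMap.comp_apply,
      hstep, ← map_add]
    congr 1
    rw [map_add]
    abel

theorem prediction_congr (x : Vec n) {z z' : ℕ → Vec m} {T : ℕ} (h : ∀ k < T, z k = z' k) :
    ∀ k ≤ T, S.prediction L x z k = S.prediction L x z' k
  | 0, _ => rfl
  | k + 1, hk => by
    rw [prediction, prediction, prediction_congr x h k (by omega), h k (by omega)]

/-- The outputs on a finite horizon as a function of the innovations, when the first prediction is
`x`. -/
def outputOfInnov (x : Vec n) (T : ℕ) (z : Fin T → Vec m) (k : Fin T) : Vec m :=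
  z k + S.C.toEuclideanLin (S.prediction L x (fun j => if h : j < T then z ⟨j, h⟩ else 0) k)

theorem outputOfInnov_eq (x : Vec n) (T : ℕ) (z : ℕ → Vec m) (k : Fin T) :
    S.outputOfInnov L x T (fun j => z j) k =
      z k + S.C.toEuclideanLin (S.prediction L x z k) := by
  -- The prediction at time `k` reads only innovations before `k`, so the default value `0` beyond
  -- the horizon is never used.
  rw [outputOfInnov, S.prediction_congr L x (z' := z) (T := T) (fun j hj => by simp [hj]) k k.2.le]

theorem measurable_outputOfInnov (x : Vec n) (T : ℕ) : Measurable (S.outputOfInnov L x T) := by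
  have hlin {a b : ℕ} (M : Matrix (Fin a) (Fin b) ℝ) : Measurable (M.toEuclideanLin) :=
    (LinearMap.continuous_of_finiteDimensional _).measurable
  have hpred (k : ℕ) : Measurable fun z : Fin T → Vec m =>
      S.prediction L x (fun j => if h : j < T then z ⟨j, h⟩ else 0) k := by
    induction k with
    | zero => exact measurable_const
    | succ k ih =>
      simp only [prediction]
      refine (hlin _).comp (ih.add ((hlin _).comp ?_))
      split_ifs <;> fun_prop
  exact measurable_pi_lambda _ fun k => (measurable_pi_apply k).add ((hlin _).comp (hpred k))

theorem output_recorded_eq (hric : S.riccatiStep S.P0 = S.P0) (x x' : Vec n) (ξ : RunNoise n m)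
    (a : AttackInput n m p' m') (hua : ∀ k, a.ua k = 0) (hd : ∀ k y, a.d k y = 0)
    (T : ℕ) (k : Fin T) :
    S.output L x' ξ a k = S.outputOfInnov L x T (fun j => S.innov ξ.1 ξ.2.1 ξ.2.2 j +
      S.C.toEuclideanLin ((S.feedbackMatrix L ^ (j : ℕ)).toEuclideanLin (x' - x))) k := by
  rw [S.outputOfInnov_eq L x T (fun j => S.innov ξ.1 ξ.2.1 ξ.2.2 j +
      S.C.toEuclideanLin ((S.feedbackMatrix L ^ j).toEuclideanLin (x' - x))),
    S.output_eq L hric x' ξ a hua hd]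
  conv_lhs => rw [← add_sub_cancel x x', S.prediction_add]
  rw [map_add]
  abel

end LinearSystem
end

/-! ### Whitening and the divergence bound. -/

noncomputable section

open scoped MatrixOrder

/-- `CFC.sqrt V * V⁻¹` plays the role of `V^{-1/2}` in `whitenedGain`. -/
theorem Matrix.PosDef.sqrt_mul_sqrt_mul_inv {m : ℕ} {V : Matrix (Fin m) (Fin m) ℝ}
    (hV : V.PosDef) : CFC.sqrt V * (CFC.sqrt V * V⁻¹) = 1 := by
  have h0 : 0 ≤ V := by
    rw [Matrix.nonneg_iff_posSemidef]; exact hV.posSemidef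
  rw [← Matrix.mul_assoc, CFC.sqrt_mul_sqrt_self V h0,
    Matrix.mul_nonsing_inv _ hV.det_pos.ne'.isUnit]

/-- A block of `T` vectors, each of them obtained from `m` real numbers by applying a square root
of `V`. -/
def colorBlocks {m : ℕ} (V : Matrix (Fin m) (Fin m) ℝ) (T : ℕ) (g : Fin T × Fin m → ℝ) :
    Fin T → Vec m :=
  fun k => Matrix.toEuclideanCLM (𝕜 := ℝ) (CFC.sqrt V) (WithLp.toLp 2 fun i => g (k, i))

theorem measurable_colorBlocks {m : ℕ} (V : Matrix (Fin m) (Fin m) ℝ) (T : ℕ) :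
    Measurable (colorBlocks V T) := by
  unfold colorBlocks
  fun_prop

theorem pi_gaussianReal_map_colorBlocks {m : ℕ} (V : Matrix (Fin m) (Fin m) ℝ) (T : ℕ) :
    (Measure.pi fun _ : Fin T × Fin m => gaussianReal 0 1).map (colorBlocks V T) =
      Measure.pi fun _ : Fin T => multivariateGaussian 0 V := by
  have hblock : (Measure.pi fun _ : Fin m => gaussianReal 0 1).map
      (fun g => Matrix.toEuclideanCLM (𝕜 := ℝ) (CFC.sqrt V) (WithLp.toLp 2 g)) =
      multivariateGaussian 0 V := by
    rw [multivariateGaussian, ← map_pi_eq_stdGaussian, Measure.map_map (by fun_prop) (by fun_prop)]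
    simp only [zero_add, Function.comp_def]
  have hcurry := Measure.infinitePi_map_curry (ι := Fin T) (κ := Fin m)
    (fun _ _ => gaussianReal 0 1)
  simp_rw [Measure.infinitePi_eq_pi] at hcurry
  rw [← hblock, ← Measure.pi_map_pi (fun _ => by fun_prop), ← hcurry,
    Measure.map_map (by fun_prop) (by fun_prop)]
  rfl

namespace LinearSystem

variable {n p m p' : ℕ} (S : LinearSystem n p m) (L : Matrix (Fin p) (Fin n) ℝ)

/-- The influence of a deviation of the first prediction on the whitened innovation at time `k`. -/
def whitenedGain (k : ℕ) : Matrix (Fin m) (Fin n) ℝ :=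
  CFC.sqrt (S.innovCov S.P0) * (S.innovCov S.P0)⁻¹ * S.C * S.feedbackMatrix L ^ k

/-- The shift of the whitened innovations caused by the first prediction being `x` instead of
`S.xhat0`. -/
def whitenedShift (T : ℕ) (x : Vec n) (q : Fin T × Fin m) : ℝ :=
  (S.whitenedGain L q.1 *ᵥ (x - S.xhat0 : Vec n)) q.2

theorem colorBlocks_add_whitenedShift (hinnov : (S.innovCov S.P0).PosDef) (T : ℕ) (x : Vec n)
    (g : Fin T × Fin m → ℝ) (k : Fin T) :
    colorBlocks (S.innovCov S.P0) T (g + S.whitenedShift L T x) k =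
      colorBlocks (S.innovCov S.P0) T g k +
        S.C.toEuclideanLin ((S.feedbackMatrix L ^ (k : ℕ)).toEuclideanLin (x - S.xhat0)) := by
  have hsplit : WithLp.toLp 2 (fun i => (g + S.whitenedShift L T x) (k, i)) =
      WithLp.toLp 2 (fun i => g (k, i)) +
        WithLp.toLp 2 (S.whitenedGain L k *ᵥ (x - S.xhat0 : Vec n)) := rfl
  rw [colorBlocks, hsplit, map_add]
  congr 1
  ext i : 1
  rw [Matrix.toEuclideanCLM_toLp, Matrix.mulVec_mulVec, whitenedGain, ← Matrix.mul_assoc,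
    ← Matrix.mul_assoc, hinnov.sqrt_mul_sqrt_mul_inv, Matrix.one_mul, ← Matrix.mulVec_mulVec]
  rfl

theorem sq_whitenedShift_le (T : ℕ) (x : Vec n) (q : Fin T × Fin m) :
    S.whitenedShift L T x q ^ 2 ≤
      (∑ j, S.whitenedGain L q.1 q.2 j ^ 2) * ‖x - S.xhat0‖ ^ 2 := by
  rw [EuclideanSpace.real_norm_sq_eq]
  exact Finset.sum_mul_sq_le_sq_mul_sq Finset.univ (S.whitenedGain L q.1 q.2)
    (x - S.xhat0 : Vec n)

theorem measurable_whitenedShift (T : ℕ) : Measurable (S.whitenedShift L T) := by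
  refine measurable_pi_lambda _ fun q => ?_
  unfold whitenedShift Matrix.mulVec dotProduct
  fun_prop

/-- The recorded first prediction stays as a coordinate; it acts only through the shift, and the
final map ignores it. -/
theorem outputLaw_replayAttack (W : Matrix (Fin n) (Fin n) ℝ) (hQ : S.Q.PosSemidef)
    (hR : S.R.PosSemidef) (hsteady : S.IsSteadyState L W) (hinnov : (S.innovCov S.P0).PosDef)
    (Ba : Matrix (Fin n) (Fin p') ℝ) (N : ℕ) (ua : Sample n m → ℕ → Vec p') (T : ℕ) :
    S.outputLaw L W (S.replayAttack L Ba N ua) T =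
      (((multivariateGaussian 0 W).prod
        (Measure.pi fun _ : Fin (T + 1) × Fin m => gaussianReal 0 1)).map
          (fun q => (q.1, q.2 + S.whitenedShift L (T + 1) q.1))).map
        (fun q => S.outputOfInnov L S.xhat0 (T + 1)
          (colorBlocks (S.innovCov S.P0) (T + 1) q.2)) := by
  have : IsProbabilityMeasure S.noiseLaw := by unfold noiseLaw; infer_instance
  have hlin {a b : ℕ} (M : Matrix (Fin a) (Fin b) ℝ) : Measurable (M.toEuclideanLin) :=
    (LinearMap.continuous_of_finiteDimensional _).measurable
  have hY := S.measurable_outputOfInnov L S.xhat0 (T + 1)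
  have hM := measurable_colorBlocks (S.innovCov S.P0) (T + 1)
  have hb := S.measurable_whitenedShift L (T + 1)
  let Φ : Vec n × (Fin (T + 1) → Vec m) → Fin (T + 1) → Vec m := fun q =>
    S.outputOfInnov L S.xhat0 (T + 1) (fun k => q.2 k +
      S.C.toEuclideanLin ((S.feedbackMatrix L ^ (k : ℕ)).toEuclideanLin (q.1 - S.xhat0)))
  have hΦ : Measurable Φ := by
    refine hY.comp (measurable_pi_lambda _ fun k => Measurable.add (by fun_prop) ?_)
    exact (hlin _).comp ((hlin _).comp (by fun_prop))
  have hinnovs : Measurable fun (ξ : RunNoise n m) (k : Fin (T + 1)) =>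
      S.innov ξ.1 ξ.2.1 ξ.2.2 k := measurable_pi_lambda _ fun k => S.measurable_innov k
  have hout : (fun (ω : Sample n m) (k : Fin (T + 1)) =>
      S.output L S.xhat0 ω.1 (S.replayAttack L Ba N ua ω) k) =
      Φ ∘ (Prod.map id fun (ξ : RunNoise n m) (k : Fin (T + 1)) =>
        S.innov ξ.1 ξ.2.1 ξ.2.2 k) ∘ Prod.snd := by
    ext ω k : 2
    rw [output_replayAttack]
    exact S.output_recorded_eq L hsteady.riccatiStep_eq S.xhat0 ω.2.1 ω.2.2 _ (fun _ => rfl)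
      (fun _ _ => rfl) (T + 1) k
  have hsnd : (S.sampleLaw W).map Prod.snd = (multivariateGaussian 0 W).prod S.noiseLaw := by
    rw [sampleLaw]; exact Measure.map_snd_prod.trans (by simp)
  rw [outputLaw, hout, ← Measure.map_map hΦ ((measurable_id.prodMap hinnovs).comp measurable_snd),
    ← Measure.map_map (measurable_id.prodMap hinnovs) measurable_snd, hsnd, ← Measure.map_prod_map _ _ measurable_id hinnovs,
    S.noiseLaw_map_innov hQ hR hsteady.posSemidef_errorCov hsteady.riccatiStep_eq hinnov,
    ← pi_gaussianReal_map_colorBlocks, Measure.map_prod_map _ _ measurable_id hM,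
    Measure.map_map hΦ (by fun_prop), Measure.map_map (by fun_prop) (by fun_prop)]
  congr 1
  ext q k : 2
  simp only [Function.comp_apply, Prod.map_fst, Prod.map_snd, id, Φ]
  congr 1
  ext k : 1
  rw [S.colorBlocks_add_whitenedShift L hinnov]

theorem outputLaw_passive (W : Matrix (Fin n) (Fin n) ℝ) (hQ : S.Q.PosSemidef)
    (hR : S.R.PosSemidef) (hsteady : S.IsSteadyState L W) (hinnov : (S.innovCov S.P0).PosDef)
    {m' : ℕ} (a : Sample n m → AttackInput n m p' m') (T : ℕ) :
    S.outputLaw L W (fun ω => (a ω).passive) T =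
      ((multivariateGaussian 0 W).prod
        (Measure.pi fun _ : Fin (T + 1) × Fin m => gaussianReal 0 1)).map
        (fun q => S.outputOfInnov L S.xhat0 (T + 1)
          (colorBlocks (S.innovCov S.P0) (T + 1) q.2)) := by
  have : IsProbabilityMeasure S.noiseLaw := by unfold noiseLaw; infer_instance
  have hY := S.measurable_outputOfInnov L S.xhat0 (T + 1)
  have hM := measurable_colorBlocks (S.innovCov S.P0) (T + 1)
  have hinnovs : Measurable fun (ξ : RunNoise n m) (k : Fin (T + 1)) =>
      S.innov ξ.1 ξ.2.1 ξ.2.2 k := measurable_pi_lambda _ fun k => S.measurable_innov k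
  have hout : (fun (ω : Sample n m) (k : Fin (T + 1)) =>
      S.output L S.xhat0 ω.1 (a ω).passive k) =
      S.outputOfInnov L S.xhat0 (T + 1) ∘ (fun (ξ : RunNoise n m) (k : Fin (T + 1)) =>
        S.innov ξ.1 ξ.2.1 ξ.2.2 k) ∘ Prod.fst := by
    ext ω k : 2
    rw [S.output_eq L hsteady.riccatiStep_eq _ _ _ (fun _ => rfl) (fun _ _ => rfl)]
    exact (S.outputOfInnov_eq L S.xhat0 (T + 1) _ k).symm
  have hfst : (S.sampleLaw W).map Prod.fst = S.noiseLaw := by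
    rw [sampleLaw]; exact Measure.map_fst_prod.trans (by simp)
  have hsnd : ((multivariateGaussian 0 W).prod
        (Measure.pi fun _ : Fin (T + 1) × Fin m => gaussianReal 0 1)).map Prod.snd =
      Measure.pi fun _ : Fin (T + 1) × Fin m => gaussianReal 0 1 :=
    Measure.map_snd_prod.trans (by simp)
  rw [outputLaw, hout, ← Measure.map_map hY (hinnovs.comp measurable_fst), ← Measure.map_map hinnovs
    measurable_fst, hfst,
    S.noiseLaw_map_innov hQ hR hsteady.posSemidef_errorCov hsteady.riccatiStep_eq hinnov,
    ← pi_gaussianReal_map_colorBlocks, Measure.map_map hY hM]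
  -- A dummy first prediction is adjoined, so that this law is an image under the same map as the
  -- law under replay.
  conv_lhs => rw [← hsnd, Measure.map_map (hY.comp hM) measurable_snd]
  rfl

/-- Data processing reduces to the Gaussian shift, and Cauchy–Schwarz separates the second moment of
the prediction deviation, finite and independent of `T`, from the gains. -/
theorem klDiv_outputLaw_le (W : Matrix (Fin n) (Fin n) ℝ) (hQ : S.Q.PosSemidef)
    (hR : S.R.PosSemidef) (hsteady : S.IsSteadyState L W) (hinnov : (S.innovCov S.P0).PosDef)
    (Ba : Matrix (Fin n) (Fin p') ℝ) (N : ℕ) (ua : Sample n m → ℕ → Vec p') (T : ℕ) :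
    klDiv (S.outputLaw L W (S.replayAttack L Ba N ua) T)
        (S.outputLaw L W (fun ω => (S.replayAttack L Ba N ua ω).passive) T) ≤
      ENNReal.ofReal ((∫ x, ‖x - S.xhat0‖ ^ 2 ∂(multivariateGaussian 0 W)) / 2 *
        ∑ k ∈ Finset.range (T + 1), ∑ i, ∑ j, S.whitenedGain L k i j ^ 2) := by
  have hb := S.measurable_whitenedShift L (T + 1)
  have hnorm : MemLp (fun x : Vec n => ‖x - S.xhat0‖) 2 (multivariateGaussian 0 W) :=
    (IsGaussian.memLp_two_id.sub (memLp_const S.xhat0)).norm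
  have hshift (q) : MemLp (fun x => S.whitenedShift L (T + 1) x q) 2
      (multivariateGaussian 0 W) := by
    refine (hnorm.const_mul (√(∑ j, S.whitenedGain L q.1 q.2 j ^ 2))).mono
      ((measurable_pi_apply q).comp hb).aestronglyMeasurable (.of_forall fun x => ?_)
    rw [Real.norm_eq_abs, Real.norm_eq_abs]
    refine sq_le_sq.1 ?_
    rw [mul_pow, Real.sq_sqrt (by positivity)]
    exact S.sq_whitenedShift_le L (T + 1) x q
  rw [S.outputLaw_replayAttack L W hQ hR hsteady hinnov,
    S.outputLaw_passive L W hQ hR hsteady hinnov]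
  refine (klDiv_map_le _ _ ((S.measurable_outputOfInnov L S.xhat0 (T + 1)).comp
    ((measurable_colorBlocks _ _).comp measurable_snd))).trans ?_
  rw [klDiv_prod_pi_gaussianReal_map_add _ hb hshift]
  refine ENNReal.ofReal_le_ofReal ?_
  calc ∫ x, ∑ q, S.whitenedShift L (T + 1) x q ^ 2 / 2 ∂(multivariateGaussian 0 W)
      ≤ ∫ x, (∑ q : Fin (T + 1) × Fin m, ∑ j, S.whitenedGain L q.1 q.2 j ^ 2) / 2 *
          ‖x - S.xhat0‖ ^ 2 ∂(multivariateGaussian 0 W) := by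
        refine integral_mono
          (integrable_finsetSum _ fun q _ => (hshift q).integrable_sq.div_const 2)
          (hnorm.integrable_sq.const_mul _) fun x => ?_
        simp only
        rw [Finset.sum_div, Finset.sum_mul]
        refine Finset.sum_le_sum fun q _ => ?_
        linarith [S.sq_whitenedShift_le L (T + 1) x q]
    _ = _ := by
        rw [integral_const_mul, Fintype.sum_prod_type, Finset.sum_range]
        ring

theorem tendsto_whitenedGain
    (hstable : spectralRadius ℂ ((S.feedbackMatrix L).map (algebraMap ℝ ℂ)) < 1) :
    Tendsto (fun k => ∑ i, ∑ j, S.whitenedGain L k i j ^ 2) atTop (𝓝 0) := by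
  have hentry (i j) : Tendsto (fun k => S.whitenedGain L k i j ^ 2) atTop (𝓝 0) := by
    have : Tendsto (fun k => S.whitenedGain L k i j) atTop (𝓝 0) := by
      simp only [whitenedGain, Matrix.mul_apply (N := S.feedbackMatrix L ^ _)]
      simpa using tendsto_finsetSum Finset.univ fun l _ =>
        (Matrix.tendsto_pow_apply_of_spectralRadius_lt_one _ hstable l j).const_mul
          ((CFC.sqrt (S.innovCov S.P0) * (S.innovCov S.P0)⁻¹ * S.C) i l)
    simpa using this.pow 2
  simpa using tendsto_finsetSum Finset.univ fun i _ =>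
    tendsto_finsetSum Finset.univ fun j _ => hentry i j

end LinearSystem
end

theorem mainTheorem5 {n p m p' : ℕ} (S : LinearSystem n p m)
    (L : Matrix (Fin p) (Fin n) ℝ) (W : Matrix (Fin n) (Fin n) ℝ)
    (hQ : S.Q.PosSemidef) (hR : S.R.PosSemidef)
    (hsteady : S.IsSteadyState L W)
    (hinnov : (S.innovCov S.P0).PosDef)
    (hstable : spectralRadius ℂ ((S.feedbackMatrix L).map (algebraMap ℝ ℂ)) < 1)
    (Ba : Matrix (Fin n) (Fin p') ℝ)
    (N : ℕ → ℕ) (hN : ∀ T, T < N T)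
    (ua : ℕ → Sample n m → ℕ → Vec p') :
    Tendsto (fun T : ℕ => S.infoFlow L W (S.replayAttack L Ba (N T) (ua T)) T) atTop (𝓝 0) := by
  -- The horizon `0, …, T` has `T + 1` terms, hence the Cesàro mean is taken at index `T + 1`.
  have hces := ((S.tendsto_whitenedGain L hstable).cesaro.comp (tendsto_add_atTop_nat 1)).const_mul
    ((∫ x, ‖x - S.xhat0‖ ^ 2 ∂(multivariateGaussian 0 W)) / 2)
  rw [mul_zero] at hces
  have hlim := ENNReal.tendsto_ofReal hces
  rw [ENNReal.ofReal_zero] at hlim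
  refine tendsto_of_tendsto_of_tendsto_of_le_of_le tendsto_const_nhds hlim
    (fun _ => zero_le) fun T => ?_
  have hT : ((T : ℝ≥0∞) + 1) = ENNReal.ofReal ((T + 1 : ℕ) : ℝ) := by
    rw [ENNReal.ofReal_natCast]; push_cast; rfl
  rw [LinearSystem.infoFlow, hT]
  refine (ENNReal.div_le_div_right
    (S.klDiv_outputLaw_le L W hQ hR hsteady hinnov Ba (N T) (ua T) T) _).trans (le_of_eq ?_)
  rw [← ENNReal.ofReal_div_of_pos (by positivity)]
  congr 1
  simp only [Function.comp_apply]
  ring
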